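/- **Setting.** Let $\mathcal C$ be a bicategory and $W$ a class of $1$-morphisms of $\mathcal C$ such that $(\mathcal C,W)$ admits a right bicalculus of fractions (associators and unitors of $\mathcal C$ are suppressed throughout): * (BF1) $\mathrm{id}_A\in W$ for every object $A$; (BF2) $W$ is closed under composition; * (BF3) for every $\mathrm v:B'\to B$ in $W$ and every $f:A'\to B$ there are $\mathrm v':A''\to A'$ in $W$, $f':A''\to B'$ and an invertible $\rho:f\circ \mathrm v'\Rightarrow \mathrm v\circ f'$; * (BF4) for every $\mathrm w:B\to A$ in $W$, $f^1,f^2:X\to B$ and $\alpha:\mathrm w\circ f^1\Rightarrow \mathrm w\circ f^2$ there are $\mathrm v:D\to X$ in $W$ and $\beta:f^1\circ \mathrm v\Rightarrow f^2\circ \mathrm v$ with $\alpha\circ \mathrm v=\mathrm w\circ\beta$, where $\beta$ can be taken invertible if $\alpha$ is invertible; and for any two such triples $(D,\mathrm v,\beta)$, $(D',\mathrm v',\beta')$ there are $\mathrm u:E\to D$, $\mathrm u':E\to D'$ and an invertible $\zeta:\mathrm v\circ \mathrm u\Rightarrow \mathrm v'\circ \mathrm u'$ with $\mathrm v\circ \mathrm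 u\in W$ and $(\beta'\circ \mathrm u')\cdot(f^1\circ\zeta)=(f^2\circ\zeta)\cdot(\beta\circ \mathrm u)$; * (BF5) if $\mathrm w\in W$ and $\mathrm v\Rightarrow \mathrm w$ is an invertible $2$-morphism, then $\mathrm v\in W$. Fix a set of choices $C(W)$: for every pair $(f,\mathrm v)$ as in (BF3), a choice of $(A'',\mathrm v',f',\rho)$. A set of choices $D(W)$ consists, for every $(\mathrm w,f^1,f^2,\alpha)$ as in (BF4), of a choice of $(D,\mathrm v,\beta)$ as there, with $\beta$ invertible whenever $\alpha$ is. In the bicategory of fractions $\mathcal C[W^{-1}]$ a $1$-morphism $A\to B$ is a triple $(A',\mathrm w,f)$ with $\mathrm w:A'\to A$ in $W$ and $f:A'\to B$. The composite of $(A',\mathrm w,f):A\to B$ and $(B',\mathrm v,g):B\to Z$ is $(A'',\mathrm w\circ \mathrm v',g\circ f')$, where $(A'',\mathrm v',f',\rho)$ is chosen by $C(W)$ for $(f,\mathrm v)$. A $2$-morphism $(A^1,\mathrm w^1,f^1)\Rightarrow(A^2,\mathrm w^2,f^2)$ is a class of data $(A^3,\mathrm v^1,\mathrm v^2,\alpha,\beta)$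 with $\mathrm v^m:A^3\to A^m$, $\mathrm w^1\circ \mathrm v^1\in W$, $\alpha:\mathrm w^1\circ \mathrm v^1\Rightarrow \mathrm w^2\circ \mathrm v^2$ invertible and $\beta:f^1\circ \mathrm v^1\Rightarrow f^2\circ \mathrm v^2$; such data are equivalent to $(A'^3,\mathrm v'^1,\mathrm v'^2,\alpha',\beta')$ if there are $\mathrm z:A^4\to A^3$, $\mathrm z':A^4\to A'^3$ and invertible $\sigma^1:\mathrm v'^1\circ \mathrm z'\Rightarrow \mathrm v^1\circ \mathrm z$, $\sigma^2:\mathrm v^2\circ \mathrm z\Rightarrow \mathrm v'^2\circ \mathrm z'$ with $\mathrm w^1\circ \mathrm v^1\circ \mathrm z\in W$, $(\mathrm w^2\circ\sigma^2)\cdot(\alpha\circ \mathrm z)\cdot(\mathrm w^1\circ\sigma^1)=\alpha'\circ \mathrm z'$ and $(f^2\circ\sigma^2)\cdot(\beta\circ \mathrm z)\cdot(f^1\circ\sigma^1)=\beta'\circ \mathrm z'$. **Definition of $\Delta\circ\underline f$.** Let $\underline f=(A',\mathrm w,f):A\to B$, $\underline g^m=(B^m,\mathrm v^m,g^m):B\to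 Z$ for $m=1,2$, and $\Delta:\underline g^1\Rightarrow\underline g^2$. Let $(D^m,\mathrm w^m,f^m,\rho^m)$ be chosen by $C(W)$ for $(f,\mathrm v^m)$, so $\underline g^m\circ\underline f=(D^m,\mathrm w\circ \mathrm w^m,g^m\circ f^m)$. Pronk's composite $\Delta\circ\underline f$, relative to $C(W)$ and $D(W)$, is obtained as follows from a representative $(B^3,\mathrm u^1,\mathrm u^2,\alpha,\beta)$ of $\Delta$. For $m=1,2$ let $C(W)$ choose $(R^m,\mathrm k^m,\tilde h^m,\tau^m)$ for $(f,\mathrm v^m\circ \mathrm u^m)$ and then $(\bar R^m,\mathrm a^m,\mathrm b^m,\lambda^m)$ for $(\mathrm k^m,\mathrm w^m)$, and let $D(W)$ choose, for $\mathrm v^m$ and the pasting of $(\rho^m)^{-1},(\lambda^m)^{-1},\tau^m$ from $\mathrm v^m\circ f^m\circ \mathrm b^m$ to $\mathrm v^m\circ \mathrm u^m\circ\tilde h^m\circ \mathrm a^m$, a morphism $\mathrm c^m$ in $W$ and an invertible $\sigma^m:f^m\circ \mathrm t^m\Rightarrow \mathrm u^m\circ h^m$, where $\mathrm t^m:=\mathrm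 b^m\circ \mathrm c^m$ and $h^m:=\tilde h^m\circ \mathrm a^m\circ \mathrm c^m$. Let $C(W)$ choose $(R,\mathrm a,\mathrm b,\tilde\varphi)$ for $(\mathrm w^1\circ \mathrm t^1,\mathrm w^2\circ \mathrm t^2)$, and let $D(W)$ choose $(D^5,\mathrm c,\delta)$ for $\mathrm v^1\circ \mathrm u^1$ and the pasting of $(\sigma^1)^{-1},(\rho^1)^{-1},\tilde\varphi,\rho^2,\sigma^2,\alpha^{-1}$ from $\mathrm v^1\circ \mathrm u^1\circ h^1\circ \mathrm a$ to $\mathrm v^1\circ \mathrm u^1\circ h^2\circ \mathrm b$. Then $\Delta\circ\underline f$ is the class of $(D^5,\mathrm t^1\circ \mathrm t^3,\mathrm t^2\circ \mathrm t^4,\mathrm w\circ\varphi,\xi)$, with $\mathrm t^3:=\mathrm a\circ \mathrm c$, $\mathrm t^4:=\mathrm b\circ \mathrm c$, $\varphi:=\tilde\varphi\circ \mathrm c$ and $\xi$ the pasting of $\sigma^1,\delta,\beta,(\sigma^2)^{-1}$ displayed in (X) below. **Proposition.** In this situation, for any set of choices $D(W)$: 1. The class $\Delta\circ\underline f$ does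 not depend on the representative of $\Delta$ used to compute it. 2. Fix any representative $(B^3,\mathrm u^1,\mathrm u^2,\alpha,\beta)$ of $\Delta$ and any set of data as follows: * (F5) morphisms $\mathrm t^1:D^3\to D^1$ and $\mathrm t^2:D^4\to D^2$ in $W$, morphisms $h^1:D^3\to B^3$ and $h^2:D^4\to B^3$, and invertible $\sigma^m:f^m\circ \mathrm t^m\Rightarrow \mathrm u^m\circ h^m$ for $m=1,2$; * (F6) a morphism $\mathrm t^3:D^5\to D^3$ in $W$, a morphism $\mathrm t^4:D^5\to D^4$ and an invertible $\varphi:\mathrm w^1\circ \mathrm t^1\circ \mathrm t^3\Rightarrow \mathrm w^2\circ \mathrm t^2\circ \mathrm t^4$; * (F7) an invertible $\delta:h^1\circ \mathrm t^3\Rightarrow h^2\circ \mathrm t^4$ such that $\mathrm v^1\circ \mathrm u^1\circ\delta$ equals $$(\alpha^{-1}\circ h^2\circ \mathrm t^4)\cdot(\mathrm v^2\circ\sigma^2\circ \mathrm t^4)\cdot(\rho^2\circ \mathrm t^2\circ \mathrm t^4)\cdot(f\circ\varphi)\cdot((\rho^1)^{-1}\circ \mathrm t^1\circ \mathrm t^3)\cdot(\mathrm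 v^1\circ(\sigma^1)^{-1}\circ \mathrm t^3).$$ Then $\Delta\circ\underline f$ is represented by $(D^5,\ \mathrm t^1\circ \mathrm t^3,\ \mathrm t^2\circ \mathrm t^4,\ \mathrm w\circ\varphi,\ \xi)$, where $$\xi:=(g^2\circ(\sigma^2)^{-1}\circ \mathrm t^4)\cdot(\beta\circ h^2\circ \mathrm t^4)\cdot(g^1\circ \mathrm u^1\circ\delta)\cdot(g^1\circ\sigma^1\circ \mathrm t^3).\tag{X}$$ 3. Given any other representative of $\Delta$ and any other data (F5)–(F7) for it, the diagram induced by the new data is equivalent to the one in 2. 4. Consequently $\Delta\circ\underline f$ is the same for all sets of choices $D(W)$ (with $C(W)$ fixed). -/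

import Mathlib

open CategoryTheory Bicategory

universe w v u

namespace BicategoryOfFractions

/-! Conventions: Mathlib writes composition of 1-morphisms in diagrammatic order, so the
composite "first `f`, then `g`" (classically `g ∘ f`) is `f ≫ g`; the classical `g ∘ η` is `η ▷ g`
and the classical `η ∘ f` is `f ◁ η`. The symbol `⊗≫` (and `≪⊗≫` for isomorphisms) is composition
of 2-morphisms up to the canonical associators and unitors. -/

section Axioms

variable {C : Type u} [Bicategory.{w, v} C]

/-- A square over the cospan `f : A' ⟶ B ⟵ B' : v`, filled by an invertible 2-morphism, whose side
opposite to `v` belongs to `W`. -/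
structure Filler (W : MorphismProperty C) {A' B B' : C} (f : A' ⟶ B) (v : B' ⟶ B) where
  apex : C
  v' : apex ⟶ A'
  f' : apex ⟶ B'
  mem : W v'
  ρ : v' ≫ f ≅ f' ≫ v

/-- A morphism `v` of `W` and a 2-morphism `β` such that `α ∘ v = w ∘ β`. -/
structure Lift (W : MorphismProperty C) {X B A : C} (w : B ⟶ A) (f₁ f₂ : X ⟶ B)
    (α : f₁ ≫ w ⟶ f₂ ≫ w) where
  apex : C
  v : apex ⟶ X
  mem : W v
  β : v ≫ f₁ ⟶ v ≫ f₂
  eq : v ◁ α = (α_ v f₁ w).inv ≫ β ▷ w ≫ (α_ v f₂ w).hom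

/-- The pair `(C, W)` admits a right bicalculus of fractions: axioms (BF1) to (BF5). -/
class AdmitsBicalculus (W : MorphismProperty C) : Prop where
  bf1 : ∀ A : C, W (𝟙 A)
  bf2 : ∀ {X Y Z : C} (f : X ⟶ Y) (g : Y ⟶ Z), W f → W g → W (f ≫ g)
  bf3 : ∀ {A' B B' : C} (f : A' ⟶ B) (v : B' ⟶ B), W v → Nonempty (Filler W f v)
  bf4ab : ∀ {X B A : C} (w : B ⟶ A), W w → ∀ (f₁ f₂ : X ⟶ B) (α : f₁ ≫ w ⟶ f₂ ≫ w),
    ∃ L : Lift W w f₁ f₂ α, IsIso α → IsIso L.β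
  bf4c : ∀ {X B A : C} (w : B ⟶ A), W w → ∀ (f₁ f₂ : X ⟶ B) (α : f₁ ≫ w ⟶ f₂ ≫ w)
    (L L' : Lift W w f₁ f₂ α),
    ∃ (E : C) (u : E ⟶ L.apex) (u' : E ⟶ L'.apex) (ζ : u ≫ L.v ≅ u' ≫ L'.v),
      W (u ≫ L.v) ∧
      ζ.hom ▷ f₁ ≫ (α_ u' L'.v f₁).hom ≫ u' ◁ L'.β =
        (α_ u L.v f₁).hom ≫ u ◁ L.β ≫ (α_ u L.v f₂).inv ≫ ζ.hom ▷ f₂ ≫ (α_ u' L'.v f₂).hom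
  bf5 : ∀ {X Y : C} (v w : X ⟶ Y), W w → (v ≅ w) → W v

/-- A set of choices `C(W)`: a filler for every cospan with right leg in `W`. -/
structure ChoicesC (W : MorphismProperty C) where
  fill : ∀ {A' B B' : C} (f : A' ⟶ B) (v : B' ⟶ B), W v → Filler W f v

/-- A set of choices `D(W)`: a lift, as provided by (BF4a) and (BF4b), for every
`α : w ∘ f₁ ⟹ w ∘ f₂` with `w` in `W`; it is invertible whenever `α` is. -/
structure ChoicesD (W : MorphismProperty C) where
  lift : ∀ {X B A : C} (w : B ⟶ A), W w → ∀ (f₁ f₂ : X ⟶ B) (α : f₁ ≫ w ⟶ f₂ ≫ w),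
    Lift W w f₁ f₂ α
  isIso : ∀ {X B A : C} (w : B ⟶ A) (hw : W w) (f₁ f₂ : X ⟶ B) (α : f₁ ≫ w ⟶ f₂ ≫ w),
    IsIso α → IsIso (lift w hw f₁ f₂ α).β

/-- The invertible lift chosen for an invertible 2-morphism. -/
noncomputable def ChoicesD.liftIso {W : MorphismProperty C} (cD : ChoicesD W) {X B A : C}
    (w : B ⟶ A) (hw : W w) (f₁ f₂ : X ⟶ B) (α : f₁ ≫ w ≅ f₂ ≫ w) :
    (cD.lift w hw f₁ f₂ α.hom).v ≫ f₁ ≅ (cD.lift w hw f₁ f₂ α.hom).v ≫ f₂ :=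
  @asIso _ _ _ _ (cD.lift w hw f₁ f₂ α.hom).β (cD.isIso w hw f₁ f₂ α.hom inferInstance)

/-- A 1-morphism `(A', w, f) : A ⟶ B` of the bicategory of fractions. -/
structure FracMor (W : MorphismProperty C) (A B : C) where
  apex : C
  w : apex ⟶ A
  mem : W w
  f : apex ⟶ B

/-- Data `(A³, v¹, v², α, β)` representing a 2-morphism of the bicategory of fractions. -/
structure FracRep {W : MorphismProperty C} {A B : C} (s t : FracMor W A B) where
  apex : C
  v₁ : apex ⟶ s.apex
  v₂ : apex ⟶ t.apex
  mem : W (v₁ ≫ s.w)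
  α : v₁ ≫ s.w ≅ v₂ ≫ t.w
  β : v₁ ≫ s.f ⟶ v₂ ≫ t.f

/-- The relation "`r` and `r'` represent the same 2-morphism". -/
def FracRep.Rel {W : MorphismProperty C} {A B : C} {s t : FracMor W A B} (r r' : FracRep s t) : Prop :=
  ∃ (E : C) (z : E ⟶ r.apex) (z' : E ⟶ r'.apex)
    (σ₁ : z' ≫ r'.v₁ ≅ z ≫ r.v₁) (σ₂ : z ≫ r.v₂ ≅ z' ≫ r'.v₂),
    W (z ≫ r.v₁ ≫ s.w) ∧
    σ₁.hom ▷ s.w ≫ (α_ z r.v₁ s.w).hom ≫ z ◁ r.α.hom ≫ (α_ z r.v₂ t.w).inv ≫ σ₂.hom ▷ t.w =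
      (α_ z' r'.v₁ s.w).hom ≫ z' ◁ r'.α.hom ≫ (α_ z' r'.v₂ t.w).inv ∧
    σ₁.hom ▷ s.f ≫ (α_ z r.v₁ s.f).hom ≫ z ◁ r.β ≫ (α_ z r.v₂ t.f).inv ≫ σ₂.hom ▷ t.f =
      (α_ z' r'.v₁ s.f).hom ≫ z' ◁ r'.β ≫ (α_ z' r'.v₂ t.f).inv

end Axioms

section Pasting

variable {C : Type u} [Bicategory.{w, v} C]
variable {A A' B B₁ B₂ B₃ D₁ D₂ D₃ D₄ D₅ Z : C} {p : A' ⟶ A} {f : A' ⟶ B}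
  {v₁ : B₁ ⟶ B} {v₂ : B₂ ⟶ B} {g₁ : B₁ ⟶ Z} {g₂ : B₂ ⟶ Z}
  {u₁ : B₃ ⟶ B₁} {u₂ : B₃ ⟶ B₂}
  {w₁ : D₁ ⟶ A'} {w₂ : D₂ ⟶ A'} {f₁ : D₁ ⟶ B₁} {f₂ : D₂ ⟶ B₂}
  {t₁ : D₃ ⟶ D₁} {t₂ : D₄ ⟶ D₂} {h₁ : D₃ ⟶ B₃} {h₂ : D₄ ⟶ B₃}
  {t₃ : D₅ ⟶ D₃} {t₄ : D₅ ⟶ D₄}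

/-- The pasting of `(σ¹)⁻¹`, `(ρ¹)⁻¹`, `φ`, `ρ²`, `σ²` and `α⁻¹`, from `v¹ ∘ u¹ ∘ h¹ ∘ t³` to
`v¹ ∘ u¹ ∘ h² ∘ t⁴`. -/
def zigzag (ρ₁ : w₁ ≫ f ≅ f₁ ≫ v₁) (ρ₂ : w₂ ≫ f ≅ f₂ ≫ v₂) (α : u₁ ≫ v₁ ≅ u₂ ≫ v₂)
    (σ₁ : t₁ ≫ f₁ ≅ h₁ ≫ u₁) (σ₂ : t₂ ≫ f₂ ≅ h₂ ≫ u₂)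
    (φ : t₃ ≫ t₁ ≫ w₁ ≅ t₄ ≫ t₂ ≫ w₂) :
    (t₃ ≫ h₁) ≫ u₁ ≫ v₁ ⟶ (t₄ ≫ h₂) ≫ u₁ ≫ v₁ :=
  𝟙 _ ⊗≫ t₃ ◁ σ₁.inv ▷ v₁ ⊗≫ (t₃ ≫ t₁) ◁ ρ₁.inv ⊗≫ φ.hom ▷ f ⊗≫
    (t₄ ≫ t₂) ◁ ρ₂.hom ⊗≫ t₄ ◁ σ₂.hom ▷ v₂ ⊗≫ (t₄ ≫ h₂) ◁ α.inv

/-- The pasting `ξ` of `σ¹`, `δ`, `β` and `(σ²)⁻¹`, from `(g¹ ∘ f¹) ∘ (t¹ ∘ t³)` to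
`(g² ∘ f²) ∘ (t² ∘ t⁴)`. -/
def xi (σ₁ : t₁ ≫ f₁ ≅ h₁ ≫ u₁) (σ₂ : t₂ ≫ f₂ ≅ h₂ ≫ u₂) (δ : t₃ ≫ h₁ ⟶ t₄ ≫ h₂)
    (β : u₁ ≫ g₁ ⟶ u₂ ≫ g₂) :
    (t₃ ≫ t₁) ≫ f₁ ≫ g₁ ⟶ (t₄ ≫ t₂) ≫ f₂ ≫ g₂ :=
  𝟙 _ ⊗≫ t₃ ◁ σ₁.hom ▷ g₁ ⊗≫ δ ▷ (u₁ ≫ g₁) ⊗≫ (t₄ ≫ h₂) ◁ β ⊗≫ t₄ ◁ σ₂.inv ▷ g₂ ⊗≫ 𝟙 _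

/-- The 2-morphism `p ∘ φ`, from `(p ∘ w¹) ∘ (t¹ ∘ t³)` to `(p ∘ w²) ∘ (t² ∘ t⁴)`. -/
def postcomp (p : A' ⟶ A) (φ : t₃ ≫ t₁ ≫ w₁ ≅ t₄ ≫ t₂ ≫ w₂) :
    (t₃ ≫ t₁) ≫ w₁ ≫ p ≅ (t₄ ≫ t₂) ≫ w₂ ≫ p :=
  Iso.refl _ ≪⊗≫ whiskerRightIso φ p ≪⊗≫ Iso.refl _

end Pasting

section TwoMorphisms

variable {C : Type u} [Bicategory.{w, v} C]

theorem rel_paste {X₁ X₂ Y Y' Y'' E F H B : C} {c₁ : X₁ ⟶ B} {c₂ : X₂ ⟶ B}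
    {a₁ : Y ⟶ X₁} {a₂ : Y ⟶ X₂} {a₁' : Y' ⟶ X₁} {a₂' : Y' ⟶ X₂} {a₁'' : Y'' ⟶ X₁}
    {a₂'' : Y'' ⟶ X₂} {z : E ⟶ Y} {z' : E ⟶ Y'} {y : F ⟶ Y'} {y'' : F ⟶ Y''}
    {p : H ⟶ E} {q : H ⟶ F}
    (σ₁ : z' ≫ a₁' ≅ z ≫ a₁) (σ₂ : z ≫ a₂ ≅ z' ≫ a₂')
    (τ₁ : y'' ≫ a₁'' ≅ y ≫ a₁') (τ₂ : y ≫ a₂' ≅ y'' ≫ a₂'')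
    (κ : p ≫ z' ≅ q ≫ y)
    (x : a₁ ≫ c₁ ⟶ a₂ ≫ c₂) (x' : a₁' ≫ c₁ ⟶ a₂' ≫ c₂) (x'' : a₁'' ≫ c₁ ⟶ a₂'' ≫ c₂)
    (h : σ₁.hom ▷ c₁ ≫ (α_ z a₁ c₁).hom ≫ z ◁ x ≫ (α_ z a₂ c₂).inv ≫ σ₂.hom ▷ c₂ =
      (α_ z' a₁' c₁).hom ≫ z' ◁ x' ≫ (α_ z' a₂' c₂).inv)
    (h' : τ₁.hom ▷ c₁ ≫ (α_ y a₁' c₁).hom ≫ y ◁ x' ≫ (α_ y a₂' c₂).inv ≫ τ₂.hom ▷ c₂ =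
      (α_ y'' a₁'' c₁).hom ≫ y'' ◁ x'' ≫ (α_ y'' a₂'' c₂).inv) :
    (Iso.refl _ ≪⊗≫ whiskerLeftIso q τ₁ ≪⊗≫ whiskerRightIso κ.symm a₁' ≪⊗≫
        whiskerLeftIso p σ₁ ≪⊗≫ Iso.refl ((p ≫ z) ≫ a₁) : (q ≫ y'') ≫ a₁'' ≅ _).hom ▷ c₁ ≫
      (α_ (p ≫ z) a₁ c₁).hom ≫ (p ≫ z) ◁ x ≫ (α_ (p ≫ z) a₂ c₂).inv ≫
      (Iso.refl _ ≪⊗≫ whiskerLeftIso p σ₂ ≪⊗≫ whiskerRightIso κ a₂' ≪⊗≫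
        whiskerLeftIso q τ₂ ≪⊗≫ Iso.refl ((q ≫ y'') ≫ a₂'') : (p ≫ z) ≫ a₂ ≅ _).hom ▷ c₂ =
      (α_ (q ≫ y'') a₁'' c₁).hom ≫ (q ≫ y'') ◁ x'' ≫ (α_ (q ≫ y'') a₂'' c₂).inv := by
  simp only [bicategoricalIsoComp, Iso.trans_hom, whiskerLeftIso_hom, whiskerRightIso_hom,
    Iso.refl_hom, Iso.symm_hom]
  calc
    _ = 𝟙 _ ⊗≫ q ◁ τ₁.hom ▷ c₁ ⊗≫ κ.inv ▷ (a₁' ≫ c₁) ⊗≫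
        p ◁ (σ₁.hom ▷ c₁ ≫ (α_ z a₁ c₁).hom ≫ z ◁ x ≫ (α_ z a₂ c₂).inv ≫ σ₂.hom ▷ c₂) ⊗≫
        κ.hom ▷ (a₂' ≫ c₂) ⊗≫ q ◁ τ₂.hom ▷ c₂ ⊗≫ 𝟙 _ := by bicategory
    _ = 𝟙 _ ⊗≫ q ◁ τ₁.hom ▷ c₁ ⊗≫ (κ.inv ▷ (a₁' ≫ c₁) ≫ (p ≫ z') ◁ x') ⊗≫
        κ.hom ▷ (a₂' ≫ c₂) ⊗≫ q ◁ τ₂.hom ▷ c₂ ⊗≫ 𝟙 _ := by rw [h]; bicategory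
    _ = 𝟙 _ ⊗≫ q ◁ τ₁.hom ▷ c₁ ⊗≫ (q ≫ y) ◁ x' ⊗≫ (κ.inv ≫ κ.hom) ▷ (a₂' ≫ c₂) ⊗≫
        q ◁ τ₂.hom ▷ c₂ ⊗≫ 𝟙 _ := by rw [← whisker_exchange]; bicategory
    _ = 𝟙 _ ⊗≫ q ◁ (τ₁.hom ▷ c₁ ≫ (α_ y a₁' c₁).hom ≫ y ◁ x' ≫ (α_ y a₂' c₂).inv ≫
        τ₂.hom ▷ c₂) ⊗≫ 𝟙 _ := by rw [Iso.inv_hom_id]; bicategory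
    _ = _ := by rw [h']; bicategory

variable {W : MorphismProperty C} [AdmitsBicalculus W] {A B : C} {s t : FracMor W A B}

theorem FracRep.rel_refl (r : FracRep s t) : r.Rel r :=
  ⟨r.apex, 𝟙 _, 𝟙 _, Iso.refl _, Iso.refl _,
    AdmitsBicalculus.bf2 _ _ (AdmitsBicalculus.bf1 _) r.mem, by simp, by simp⟩

theorem FracRep.rel_symm {r r' : FracRep s t} (h : r.Rel r') : r'.Rel r := by
  obtain ⟨E, z, z', σ₁, σ₂, hW, hα, hβ⟩ := h
  refine ⟨E, z', z, σ₁.symm, σ₂.symm, ?_, ?_, ?_⟩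
  · exact AdmitsBicalculus.bf5 _ _ hW
      ((α_ _ _ _).symm ≪≫ whiskerRightIso σ₁ s.w ≪≫ α_ _ _ _)
  · have := congrArg (fun x => σ₁.inv ▷ s.w ≫ x ≫ σ₂.inv ▷ t.w) hα
    simp only [Category.assoc, inv_hom_whiskerRight_assoc, hom_inv_whiskerRight] at this
    simpa using this.symm
  · have := congrArg (fun x => σ₁.inv ▷ s.f ≫ x ≫ σ₂.inv ▷ t.f) hβ
    simp only [Category.assoc, inv_hom_whiskerRight_assoc, hom_inv_whiskerRight] at this
    simpa using this.symm

theorem FracRep.rel_trans {r r' r'' : FracRep s t} (h : r.Rel r') (h' : r'.Rel r'') : r.Rel r'' := by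
  obtain ⟨E, z, z', σ₁, σ₂, hW, hα, hβ⟩ := h
  obtain ⟨F, y, y'', τ₁, τ₂, hW', hα', hβ'⟩ := h'
  obtain ⟨⟨G, e, e', he, ι⟩⟩ :=
    AdmitsBicalculus.bf3 (W := W) (z' ≫ r'.v₁ ≫ s.w) (y ≫ r'.v₁ ≫ s.w) hW'
  obtain ⟨⟨H, p, hp, κ, _⟩, hκ⟩ := AdmitsBicalculus.bf4ab (W := W) (r'.v₁ ≫ s.w) r'.mem
    (e ≫ z') (e' ≫ y) ((α_ _ _ _).hom ≫ ι.hom ≫ (α_ _ _ _).inv)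
  have hκ' : IsIso κ := hκ inferInstance
  let κ' : (p ≫ e) ≫ z' ≅ (p ≫ e') ≫ y := α_ _ _ _ ≪≫ asIso κ ≪≫ (α_ _ _ _).symm
  refine ⟨H, (p ≫ e) ≫ z, (p ≫ e') ≫ y'', _, _, ?_,
    rel_paste σ₁ σ₂ τ₁ τ₂ κ' _ _ _ hα hα', rel_paste σ₁ σ₂ τ₁ τ₂ κ' _ _ _ hβ hβ'⟩
  exact AdmitsBicalculus.bf5 _ _
    (AdmitsBicalculus.bf2 _ _ (AdmitsBicalculus.bf2 _ _ hp he) hW) (α_ _ _ _)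

/-- The relation on representatives is an equivalence relation. -/
instance FracRep.setoid (s t : FracMor W A B) : Setoid (FracRep s t) where
  r := FracRep.Rel
  iseqv := ⟨FracRep.rel_refl, FracRep.rel_symm, FracRep.rel_trans⟩

/-- The 2-morphisms `s ⟹ t` of the bicategory of fractions. -/
abbrev TwoMor (s t : FracMor W A B) := Quotient (FracRep.setoid s t)

/-- The data `r` represent the 2-morphism `Γ`. -/
def FracRep.Represents (r : FracRep s t) (Γ : TwoMor s t) : Prop := ⟦r⟧ = Γ

/-- The composite `g ∘ f` of 1-morphisms determined by the choices `C(W)`. -/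
def ChoicesC.comp (cC : ChoicesC W) {Z : C} (f : FracMor W A B) (g : FracMor W B Z) : FracMor W A Z where
  apex := (cC.fill f.f g.w g.mem).apex
  w := (cC.fill f.f g.w g.mem).v' ≫ f.w
  mem := AdmitsBicalculus.bf2 _ _ (cC.fill f.f g.w g.mem).mem f.mem
  f := (cC.fill f.f g.w g.mem).f' ≫ g.f

end TwoMorphisms

section Whiskering

variable {C : Type u} [Bicategory.{w, v} C] {W : MorphismProperty C}

theorem FracRep.mem₂ [AdmitsBicalculus W] {A B : C} {s t : FracMor W A B} (r : FracRep s t) :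
    W (r.v₂ ≫ t.w) :=
  AdmitsBicalculus.bf5 _ _ r.mem r.α.symm

/-- Auxiliary data for the composite with `f = (A', w, f)` of the 2-morphism represented by
`r = (B³, u¹, u², α, β)`, from `g¹ = (B¹, v¹, g¹)` to `g² = (B², v², g²)`, where
`(D^m, w^m, f^m, ρ^m)` is the square chosen by `C(W)` for the pair `(f, v^m)`. -/
structure WhiskerData (cC : ChoicesC W) {A B Z : C} (f : FracMor W A B) {g₁ g₂ : FracMor W B Z}
    (r : FracRep g₁ g₂) where
  /-- `(D³, t¹, h¹, σ¹)` -/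
  S₁ : Filler W (cC.fill f.f g₁.w g₁.mem).f' r.v₁
  /-- `(D⁴, t², h², σ²)` -/
  S₂ : Filler W (cC.fill f.f g₂.w g₂.mem).f' r.v₂
  /-- `(D⁵, t³, t⁴, φ)` over the pair `(w¹ ∘ t¹, w² ∘ t²)` -/
  S₃ : Filler W (S₁.v' ≫ (cC.fill f.f g₁.w g₁.mem).v') (S₂.v' ≫ (cC.fill f.f g₂.w g₂.mem).v')
  δ : S₃.v' ≫ S₁.f' ≅ S₃.f' ≫ S₂.f'
  eq : δ.hom ▷ (r.v₁ ≫ g₁.w) =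
    zigzag (cC.fill f.f g₁.w g₁.mem).ρ (cC.fill f.f g₂.w g₂.mem).ρ r.α S₁.ρ S₂.ρ S₃.ρ

/-- The diagram `(D⁵, t¹ ∘ t³, t² ∘ t⁴, w ∘ φ, ξ)` induced by the auxiliary data. -/
def WhiskerData.diagram [AdmitsBicalculus W] {cC : ChoicesC W} {A B Z : C} {f : FracMor W A B}
    {g₁ g₂ : FracMor W B Z} {r : FracRep g₁ g₂} (F : WhiskerData cC f r) :
    FracRep (cC.comp f g₁) (cC.comp f g₂) where
  apex := F.S₃.apex
  v₁ := F.S₃.v' ≫ F.S₁.v'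
  v₂ := F.S₃.f' ≫ F.S₂.v'
  mem := AdmitsBicalculus.bf2 _ _ (AdmitsBicalculus.bf2 _ _ F.S₃.mem F.S₁.mem)
    (cC.comp f g₁).mem
  α := postcomp f.w F.S₃.ρ
  β := xi F.S₁.ρ F.S₂.ρ F.δ.hom r.β

/-- A square like `S₁` and `S₂` in `WhiskerData`, but with `w^m ∘ t` (instead of `t`) in `W`. -/
structure Leg (W : MorphismProperty C) {A' Y X D : C} (w' : D ⟶ A') (f' : D ⟶ Y) (u : X ⟶ Y) where
  apex : C
  t : apex ⟶ D
  h : apex ⟶ X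
  mem : W (t ≫ w')
  σ : t ≫ f' ≅ h ≫ u

/-- First half of Pronk's construction of `Δ ∘ f`, carried out for `m = 1` and `m = 2`. It is
applied to `f = (A', w, f)`, to `g = (B^m, v^m, g^m)` and to a morphism `u : B³ ⟶ B^m` such that
`v^m ∘ u` is in `W`. The steps are:
* `S = (D^m, w^m, f^m, ρ)` is the square chosen by `C(W)` for `(f, v^m)`;
* `T = (R, k, h, τ)` is the square chosen by `C(W)` for `(f, v^m ∘ u)`;
* `L = (R', a, b, l)` is the square chosen by `C(W)` for `(k, w^m)`, so `l : k ∘ a ⟹ w^m ∘ b`;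
* `θ` is the pasting `v^m ∘ f^m ∘ b ⟹ f ∘ w^m ∘ b ⟹ f ∘ k ∘ a ⟹ v^m ∘ u ∘ h ∘ a` of
  `ρ⁻¹`, `l⁻¹` and `τ`;
* `D(W)` chooses for `θ` a morphism `c` in `W` and an invertible
  `σ : f^m ∘ b ∘ c ⟹ u ∘ h ∘ a ∘ c` with `v^m ∘ σ = θ ∘ c`. -/
noncomputable def pronkLeg [AdmitsBicalculus W] (cC : ChoicesC W) (cD : ChoicesD W) {A B Z X : C}
    (f : FracMor W A B) (g : FracMor W B Z) (u : X ⟶ g.apex) (hu : W (u ≫ g.w)) :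
    Leg W (cC.fill f.f g.w g.mem).v' (cC.fill f.f g.w g.mem).f' u :=
  let S := cC.fill f.f g.w g.mem
  let T := cC.fill f.f (u ≫ g.w) hu
  let L := cC.fill T.v' S.v' S.mem
  let θ : (L.f' ≫ S.f') ≫ g.w ≅ (L.v' ≫ T.f' ≫ u) ≫ g.w :=
    Iso.refl _ ≪⊗≫ whiskerLeftIso L.f' S.ρ.symm ≪⊗≫ whiskerRightIso L.ρ.symm f.f ≪⊗≫
      whiskerLeftIso L.v' T.ρ ≪⊗≫ Iso.refl _
  let c := cD.lift g.w g.mem (L.f' ≫ S.f') (L.v' ≫ T.f' ≫ u) θ.hom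
  { apex := c.apex
    t := c.v ≫ L.f'
    h := c.v ≫ L.v' ≫ T.f'
    mem := AdmitsBicalculus.bf5 _ _
      (AdmitsBicalculus.bf2 _ _ c.mem (AdmitsBicalculus.bf2 _ _ L.mem T.mem))
      (α_ _ _ _ ≪≫ whiskerLeftIso c.v L.ρ.symm)
    σ := Iso.refl _ ≪⊗≫ cD.liftIso g.w g.mem (L.f' ≫ S.f') (L.v' ≫ T.f' ≫ u) θ ≪⊗≫ Iso.refl _ }

/-- Pronk's construction of a representative of `Δ ∘ f` from a representative
`r = (B³, u¹, u², α, β)` of `Δ : g¹ ⟹ g²` and the choices `C(W)`, `D(W)`: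
* `P^m = (D^{m+2}, t^m, h^m, σ^m)` is given by `pronkLeg`;
* `Q = (R, a, b, φ)` is the square chosen by `C(W)` for `(w¹ ∘ t¹, w² ∘ t²)`;
* `K = (D⁵, c, δ)` is chosen by `D(W)` for `v¹ ∘ u¹` and the pasting of `(σ¹)⁻¹`, `(ρ¹)⁻¹`, `φ`,
  `ρ²`, `σ²` and `α⁻¹`;
* the result is `(D⁵, t¹ ∘ (a ∘ c), t² ∘ (b ∘ c), w ∘ (φ ∘ c), ξ)`. -/
noncomputable def pronkRep [AdmitsBicalculus W] (cC : ChoicesC W) (cD : ChoicesD W) {A B Z : C}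
    (f : FracMor W A B) {g₁ g₂ : FracMor W B Z} (r : FracRep g₁ g₂) :
    FracRep (cC.comp f g₁) (cC.comp f g₂) :=
  let S₁ := cC.fill f.f g₁.w g₁.mem
  let S₂ := cC.fill f.f g₂.w g₂.mem
  let P₁ := pronkLeg cC cD f g₁ r.v₁ r.mem
  let P₂ := pronkLeg cC cD f g₂ r.v₂ r.mem₂
  let Q := cC.fill (P₁.t ≫ S₁.v') (P₂.t ≫ S₂.v') P₂.mem
  let K := cD.lift (r.v₁ ≫ g₁.w) r.mem (Q.v' ≫ P₁.h) (Q.f' ≫ P₂.h)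
    (zigzag S₁.ρ S₂.ρ r.α P₁.σ P₂.σ Q.ρ)
  let φ : (K.v ≫ Q.v') ≫ P₁.t ≫ S₁.v' ≅ (K.v ≫ Q.f') ≫ P₂.t ≫ S₂.v' :=
    α_ _ _ _ ≪≫ whiskerLeftIso K.v Q.ρ ≪≫ (α_ _ _ _).symm
  let δ : (K.v ≫ Q.v') ≫ P₁.h ⟶ (K.v ≫ Q.f') ≫ P₂.h :=
    (α_ _ _ _).hom ≫ K.β ≫ (α_ _ _ _).inv
  { apex := K.apex
    v₁ := (K.v ≫ Q.v') ≫ P₁.t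
    v₂ := (K.v ≫ Q.f') ≫ P₂.t
    mem := AdmitsBicalculus.bf5 _ _
      (AdmitsBicalculus.bf2 _ _ (AdmitsBicalculus.bf2 _ _ K.mem Q.mem)
        (AdmitsBicalculus.bf2 _ _ P₁.mem f.mem))
      (α_ _ _ _ ≪≫ whiskerLeftIso (K.v ≫ Q.v') (α_ _ _ _).symm)
    α := postcomp f.w φ
    β := xi P₁.σ P₂.σ δ r.β }

/-- The horizontal composite `Γ ∘ f` in the bicategory of fractions built from the choices `C(W)`
and `D(W)`: the class of Pronk's diagram for some representative of `Γ`. -/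
noncomputable def compLeft [AdmitsBicalculus W] (cC : ChoicesC W) (cD : ChoicesD W) {A B Z : C}
    (f : FracMor W A B) {g₁ g₂ : FracMor W B Z} (Γ : TwoMor g₁ g₂) :
    TwoMor (cC.comp f g₁) (cC.comp f g₂) :=
  ⟦pronkRep cC cD f Γ.out⟧

end Whiskering

end BicategoryOfFractions

open BicategoryOfFractions

namespace BicategoryOfFractions

/-! ### Comparing 2-morphisms after restriction -/

section Transformations

variable {C : Type u} [Bicategory.{w, v} C]

/-! Pronk's construction and arbitrary data (F5)–(F7) both yield diagrams with one common property,
`IsPasting`: composed with f¹ and f², the two legs factor up to isomorphism through a single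
morphism k into the apex of the representative, compatibly with α and β. One takes k = h² ∘ t⁴ and
absorbs δ into the comparison on the first leg; membership of t¹ and t² in W plays no role.
Everything therefore reduces to `IsWhiskering.rel`: pastings over equivalent representatives are
equivalent.

For a fixed representative this is `IsPasting.exists_compatible`. Axiom (BF3), followed by a lift,
makes the first legs agree; lifting along morphisms of W carries the agreement to the second legs
and to the morphisms k. The comparison isomorphisms s¹, s² then match only after composition with
v¹, v², but morphisms of W are faithful on 2-morphisms up to restriction (`exists_whiskerLeft_eq`),
so a further restriction makes them match. The component over Z is determined by s¹, s² and β, hence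
matches too.

A change of representative is handled by `IsPasting.exists_restrict`: after restriction, k factors
through the object witnessing the equivalence, and so can be rerouted to the other representative.
-/

/-- Whiskering a 2-morphism `q ∘ x ⟹ q' ∘ y` with `g`, with the composites reassociated. -/
def whisk {X Y Y' Q R : C} {x : X ⟶ Y} {y : X ⟶ Y'} {q : Y ⟶ Q} {q' : Y' ⟶ Q}
    (m : x ≫ q ⟶ y ≫ q') (g : Q ⟶ R) : x ≫ q ≫ g ⟶ y ≫ q' ≫ g :=
  (α_ x q g).inv ≫ m ▷ g ≫ (α_ y q' g).hom

instance {X Y Y' Q R : C} {x : X ⟶ Y} {y : X ⟶ Y'} {q : Y ⟶ Q} {q' : Y' ⟶ Q}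
    (m : x ≫ q ⟶ y ≫ q') [IsIso m] (g : Q ⟶ R) : IsIso (whisk m g) := by
  unfold whisk; infer_instance

/-- Restriction of an isomorphism `x ∘ e ≅ x' ∘ e'` along `v`. -/
def restrictIso {F E X X' Y : C} (v : F ⟶ E) {e : E ⟶ X} {e' : E ⟶ X'} {x : X ⟶ Y} {x' : X' ⟶ Y}
    (a : e ≫ x ≅ e' ≫ x') : (v ≫ e) ≫ x ≅ (v ≫ e') ≫ x' :=
  α_ _ _ _ ≪≫ whiskerLeftIso v a ≪≫ (α_ _ _ _).symm

/-- The 2-morphisms `m` and `m'` agree after restriction along `e` and `e'`, up to the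
2-morphisms `a` and `b` comparing their sources and their targets. -/
def Compatible {E X X' Y Y' Q : C} {e : E ⟶ X} {e' : E ⟶ X'} {x : X ⟶ Y} {x' : X' ⟶ Y}
    {y : X ⟶ Y'} {y' : X' ⟶ Y'} {q : Y ⟶ Q} {q' : Y' ⟶ Q}
    (m : x ≫ q ⟶ y ≫ q') (m' : x' ≫ q ⟶ y' ≫ q')
    (a : e ≫ x ⟶ e' ≫ x') (b : e ≫ y ⟶ e' ≫ y') : Prop :=
  (α_ e x q).hom ≫ e ◁ m ≫ (α_ e y q').inv ≫ b ▷ q' =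
    a ▷ q ≫ (α_ e' x' q).hom ≫ e' ◁ m' ≫ (α_ e' y' q').inv

namespace Compatible

variable {E X X' Y Y' Y'' Q R : C} {e : E ⟶ X} {e' : E ⟶ X'} {x : X ⟶ Y} {x' : X' ⟶ Y}
  {y : X ⟶ Y'} {y' : X' ⟶ Y'} {z : X ⟶ Y''} {z' : X' ⟶ Y''}
  {q : Y ⟶ Q} {q' : Y' ⟶ Q} {q'' : Y'' ⟶ Q}
  {m : x ≫ q ⟶ y ≫ q'} {m' : x' ≫ q ⟶ y' ≫ q'} {n : y ≫ q' ⟶ z ≫ q''} {n' : y' ≫ q' ⟶ z' ≫ q''}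
  {a : e ≫ x ⟶ e' ≫ x'} {b : e ≫ y ⟶ e' ≫ y'} {c : e ≫ z ⟶ e' ≫ z'}

theorem comp (h : Compatible m m' a b) (k : Compatible n n' b c) :
    Compatible (m ≫ n) (m' ≫ n') a c := by
  unfold Compatible at *
  calc
    _ = ((α_ e x q).hom ≫ e ◁ m ≫ (α_ e y q').inv) ≫
        ((α_ e y q').hom ≫ e ◁ n ≫ (α_ e z q'').inv ≫ c ▷ q'') := by simp
    _ = ((α_ e x q).hom ≫ e ◁ m ≫ (α_ e y q').inv ≫ b ▷ q') ≫
        (α_ e' y' q').hom ≫ e' ◁ n' ≫ (α_ e' z' q'').inv := by rw [k]; simp only [Category.assoc]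
    _ = _ := by rw [h]; simp

/-- Cancellation of an invertible factor: with `of_comp_right` and `comp` this is a two-out-of-three
rule, used to strip known cells off a pasted identity. -/
theorem of_comp_left [IsIso m] (h : Compatible m m' a b) (k : Compatible (m ≫ n) (m' ≫ n') a c) :
    Compatible n n' b c := by
  unfold Compatible at *
  have : IsIso ((α_ e x q).hom ≫ e ◁ m ≫ (α_ e y q').inv) := inferInstance
  rw [← cancel_epi ((α_ e x q).hom ≫ e ◁ m ≫ (α_ e y q').inv)]
  calc
    _ = (α_ e x q).hom ≫ e ◁ (m ≫ n) ≫ (α_ e z q'').inv ≫ c ▷ q'' := by simp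
    _ = (a ▷ q ≫ (α_ e' x' q).hom ≫ e' ◁ m' ≫ (α_ e' y' q').inv) ≫
        (α_ e' y' q').hom ≫ e' ◁ n' ≫ (α_ e' z' q'').inv := by rw [k]; simp
    _ = _ := by rw [← h]; simp only [Category.assoc]

theorem of_comp_right [IsIso n'] (h : Compatible n n' b c) (k : Compatible (m ≫ n) (m' ≫ n') a c) :
    Compatible m m' a b := by
  unfold Compatible at *
  rw [← cancel_mono ((α_ e' y' q').hom ≫ e' ◁ n' ≫ (α_ e' z' q'').inv)]
  calc
    _ = (α_ e x q).hom ≫ e ◁ m ≫ (α_ e y q').inv ≫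
        (b ▷ q' ≫ (α_ e' y' q').hom ≫ e' ◁ n' ≫ (α_ e' z' q'').inv) := by
      simp only [Category.assoc]
    _ = (α_ e x q).hom ≫ e ◁ (m ≫ n) ≫ (α_ e z q'').inv ≫ c ▷ q'' := by rw [← h]; simp
    _ = _ := by rw [k]; simp

/-- The interchange law: a cell common to both sides, such as ρ, α or β, imposes no condition on the
comparison. -/
theorem whiskerLeft {q₁ q₂ : Y ⟶ Q} (a : e ≫ x ⟶ e' ≫ x') (γ : q₁ ⟶ q₂) :
    Compatible (x ◁ γ) (x' ◁ γ) a a := by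
  unfold Compatible
  rw [← comp_whiskerLeft_assoc, whisker_exchange, comp_whiskerLeft]

theorem whisk (h : Compatible m m' a b) (g : Q ⟶ R) :
    Compatible (whisk m g) (whisk m' g) a b := by
  unfold Compatible BicategoryOfFractions.whisk at *
  calc
    _ = 𝟙 _ ⊗≫ ((α_ e x q).hom ≫ e ◁ m ≫ (α_ e y q').inv ≫ b ▷ q') ▷ g ⊗≫ 𝟙 _ := by bicategory
    _ = _ := by rw [h]; bicategory

theorem restrict {a : e ≫ x ≅ e' ≫ x'} {b : e ≫ y ≅ e' ≫ y'} (h : Compatible m m' a.hom b.hom)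
    {F : C} (v : F ⟶ E) : Compatible m m' (restrictIso v a).hom (restrictIso v b).hom := by
  unfold Compatible restrictIso at *
  calc
    _ = 𝟙 _ ⊗≫ v ◁ ((α_ e x q).hom ≫ e ◁ m ≫ (α_ e y q').inv ≫ b.hom ▷ q') ⊗≫ 𝟙 _ := by
      simp only [Iso.trans_hom, whiskerLeftIso_hom, Iso.symm_hom]; bicategory
    _ = _ := by
      rw [h]; simp only [Iso.trans_hom, whiskerLeftIso_hom, Iso.symm_hom]; bicategory

end Compatible

/-! ### Lifting and cancelling along morphisms of W -/

variable {W : MorphismProperty C} [AdmitsBicalculus W]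

theorem exists_iso_lift {X B A : C} {w : B ⟶ A} (hw : W w) {f₁ f₂ : X ⟶ B}
    (α : f₁ ≫ w ≅ f₂ ≫ w) :
    ∃ (D : C) (v : D ⟶ X) (β : v ≫ f₁ ≅ v ≫ f₂), W v ∧
      v ◁ α.hom = (α_ v f₁ w).inv ≫ β.hom ▷ w ≫ (α_ v f₂ w).hom := by
  obtain ⟨⟨D, v, hv, β, h⟩, hβ⟩ := AdmitsBicalculus.bf4ab (W := W) w hw f₁ f₂ α.hom
  have : IsIso β := hβ inferInstance
  exact ⟨D, v, asIso β, hv, h⟩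

/-- Both 2-morphisms are lifts of the same cell along the identity, so the uniqueness clause of
(BF4) relates them by an invertible ζ. By interchange ζ can be moved to the same side of both, where
it cancels. -/
theorem exists_whiskerLeft_eq {X B A : C} {w : B ⟶ A} (hw : W w) {f₁ f₂ : X ⟶ B}
    {β β' : f₁ ⟶ f₂} (h : β ▷ w = β' ▷ w) :
    ∃ (D : C) (v : D ⟶ X), W v ∧ v ◁ β = v ◁ β' := by
  obtain ⟨E, z, z', ζ, hz, hζ⟩ := AdmitsBicalculus.bf4c (W := W) w hw f₁ f₂ (β ▷ w)
    ⟨X, 𝟙 X, AdmitsBicalculus.bf1 X, 𝟙 X ◁ β, by simp⟩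
    ⟨X, 𝟙 X, AdmitsBicalculus.bf1 X, 𝟙 X ◁ β', by rw [h]; simp⟩
  refine ⟨E, z ≫ 𝟙 X, hz, ?_⟩
  dsimp only at z z' ζ hζ
  have key : ζ.hom ▷ f₁ ≫ (z' ≫ 𝟙 X) ◁ β' = (z ≫ 𝟙 X) ◁ β ≫ ζ.hom ▷ f₂ := by
    rw [← cancel_mono (α_ z' (𝟙 X) f₂).hom]
    simpa using hζ
  rw [← whisker_exchange] at key
  exact ((cancel_mono _).1 key).symm

/-- Squares over a cospan whose right leg `z` need not be in `W`, provided that some composite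
`q ∘ z` with `q` in `W` is. -/
theorem exists_square {X Y Z Q : C} (k : X ⟶ Y) {z : Z ⟶ Y} {q : Y ⟶ Q} (hq : W q)
    (hz : W (z ≫ q)) :
    ∃ (E : C) (e : E ⟶ X) (e' : E ⟶ Z), W e ∧ Nonempty (e ≫ k ≅ e' ≫ z) := by
  obtain ⟨⟨E, e, e', he, ρ⟩⟩ := AdmitsBicalculus.bf3 (W := W) (k ≫ q) (z ≫ q) hz
  obtain ⟨D, v, β, hv, -⟩ := exists_iso_lift hq (f₁ := e ≫ k) (f₂ := e' ≫ z)
    (α_ _ _ _ ≪≫ ρ ≪≫ (α_ _ _ _).symm)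
  exact ⟨D, v ≫ e, v ≫ e', AdmitsBicalculus.bf2 _ _ hv he,
    ⟨α_ _ _ _ ≪≫ β ≪≫ (α_ _ _ _).symm⟩⟩

variable {E X X' Y Y' Q R : C} {e : E ⟶ X} {e' : E ⟶ X'} {x : X ⟶ Y} {x' : X' ⟶ Y}
  {y : X ⟶ Y'} {y' : X' ⟶ Y'} {q : Y ⟶ Q} {q' : Y' ⟶ Q}

/-- Conjugating a by m and m' compares the targets after composition with q'; lifting this
isomorphism along q' gives b. -/
theorem exists_compatible (hq' : W q') (m : x ≫ q ⟶ y ≫ q') (m' : x' ≫ q ⟶ y' ≫ q') [IsIso m]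
    [IsIso m'] (a : e ≫ x ≅ e' ≫ x') :
    ∃ (F : C) (v : F ⟶ E) (b : (v ≫ e) ≫ y ≅ (v ≫ e') ≫ y'), W v ∧
      Compatible m m' (restrictIso v a).hom b.hom := by
  obtain ⟨F, v, β, hv, h⟩ := exists_iso_lift hq' (f₁ := e ≫ y) (f₂ := e' ≫ y')
    (α_ _ _ _ ≪≫ whiskerLeftIso e (asIso m).symm ≪≫ (α_ _ _ _).symm ≪≫ whiskerRightIso a q ≪≫
      α_ _ _ _ ≪≫ whiskerLeftIso e' (asIso m') ≪≫ (α_ _ _ _).symm)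
  refine ⟨F, v, α_ _ _ _ ≪≫ β ≪≫ (α_ _ _ _).symm, hv, ?_⟩
  have h' : β.hom ▷ q' = (α_ _ _ _).hom ≫ v ◁ ((α_ e y q').hom ≫ e ◁ inv m ≫ (α_ e x q).inv ≫
      a.hom ▷ q ≫ (α_ e' x' q).hom ≫ e' ◁ m' ≫ (α_ e' y' q').inv) ≫ (α_ _ _ _).inv := by
    rw [← cancel_epi (α_ _ _ _).inv, ← cancel_mono (α_ _ _ _).hom]
    simpa using h.symm
  unfold Compatible restrictIso
  simp only [Iso.trans_hom, whiskerLeftIso_hom, Iso.symm_hom, comp_whiskerRight, h']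
  calc
    _ = 𝟙 _ ⊗≫ (v ≫ e) ◁ (m ≫ inv m) ⊗≫ v ◁ a.hom ▷ q ⊗≫ (v ≫ e') ◁ m' ⊗≫ 𝟙 _ := by bicategory
    _ = _ := by rw [IsIso.hom_inv_id]; bicategory

/-- Compatibility is an equation of 2-morphisms, so `exists_whiskerLeft_eq` cancels g from it at the
cost of a restriction. -/
theorem exists_compatible_of_whisk {g : Q ⟶ R} (hg : W g) {m : x ≫ q ⟶ y ≫ q'}
    {m' : x' ≫ q ⟶ y' ≫ q'} {a : e ≫ x ≅ e' ≫ x'} {b : e ≫ y ≅ e' ≫ y'}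
    (h : Compatible (whisk m g) (whisk m' g) a.hom b.hom) :
    ∃ (F : C) (v : F ⟶ E), W v ∧ Compatible m m' (restrictIso v a).hom (restrictIso v b).hom := by
  obtain ⟨F, v, hv, key⟩ := exists_whiskerLeft_eq hg
    (β := (α_ e x q).hom ≫ e ◁ m ≫ (α_ e y q').inv ≫ b.hom ▷ q')
    (β' := a.hom ▷ q ≫ (α_ e' x' q).hom ≫ e' ◁ m' ≫ (α_ e' y' q').inv) (by
      unfold Compatible whisk at h
      calc
        _ = 𝟙 _ ⊗≫ ((α_ e x (q ≫ g)).hom ≫ e ◁ ((α_ x q g).inv ≫ m ▷ g ≫ (α_ y q' g).hom) ≫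
            (α_ e y (q' ≫ g)).inv ≫ b.hom ▷ (q' ≫ g)) ⊗≫ 𝟙 _ := by bicategory
        _ = _ := by rw [h]; bicategory)
  refine ⟨F, v, hv, ?_⟩
  unfold Compatible restrictIso
  calc
    _ = 𝟙 _ ⊗≫ v ◁ ((α_ e x q).hom ≫ e ◁ m ≫ (α_ e y q').inv ≫ b.hom ▷ q') ⊗≫ 𝟙 _ := by
      simp only [Iso.trans_hom, whiskerLeftIso_hom, Iso.symm_hom]; bicategory
    _ = _ := by
      rw [key]; simp only [Iso.trans_hom, whiskerLeftIso_hom, Iso.symm_hom]; bicategory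

end Transformations

/-! ### Pastings over a representative and their equivalence -/

section Whiskerings

variable {C : Type u} [Bicategory.{w, v} C] {W : MorphismProperty C} [AdmitsBicalculus W]

/-- Restriction of a representative along a morphism of `W`. -/
def FracRep.restrict {A B : C} {s t : FracMor W A B} (d : FracRep s t) {F : C} (e : F ⟶ d.apex)
    (he : W e) : FracRep s t where
  apex := F
  v₁ := e ≫ d.v₁
  v₂ := e ≫ d.v₂
  mem := AdmitsBicalculus.bf5 _ _ (AdmitsBicalculus.bf2 _ _ he d.mem) (α_ _ _ _)
  α := α_ _ _ _ ≪≫ whiskerLeftIso e d.α ≪≫ (α_ _ _ _).symm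
  β := (α_ _ _ _).hom ≫ e ◁ d.β ≫ (α_ _ _ _).inv

theorem FracRep.rel_of_compatible {A B : C} {s t : FracMor W A B} {d d' : FracRep s t} {E : C}
    {e : E ⟶ d.apex} {e' : E ⟶ d'.apex} (he : W e) (a₁ : e ≫ d.v₁ ≅ e' ≫ d'.v₁)
    (a₂ : e ≫ d.v₂ ≅ e' ≫ d'.v₂) (hα : Compatible d.α.hom d'.α.hom a₁.hom a₂.hom)
    (hβ : Compatible d.β d'.β a₁.hom a₂.hom) : d.Rel d' := by
  refine ⟨E, e, e', a₁.symm, a₂, AdmitsBicalculus.bf2 _ _ he d.mem, ?_, ?_⟩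
  · rw [hα]; simp
  · rw [hβ]; simp

theorem FracRep.rel_restrict {A B : C} {s t : FracMor W A B} (d : FracRep s t) {F : C}
    (e : F ⟶ d.apex) (he : W e) : d.Rel (d.restrict e he) := by
  refine FracRep.rel_of_compatible (e := e) (e' := 𝟙 F) he (λ_ _).symm (λ_ _).symm ?_ ?_
  · simp only [Compatible, FracRep.restrict, Iso.trans_hom, whiskerLeftIso_hom, Iso.symm_hom]
    bicategory
  · simp only [Compatible, FracRep.restrict, Iso.symm_hom]
    bicategory

section IsPasting

variable {A A' B Z B₁ B₂ X X' D₁ D₂ D D' : C} {p : A' ⟶ A} {f : A' ⟶ B}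
  {v₁ : B₁ ⟶ B} {v₂ : B₂ ⟶ B} {g₁ : B₁ ⟶ Z} {g₂ : B₂ ⟶ Z} {u₁ : X ⟶ B₁} {u₂ : X ⟶ B₂}
  {u₁' : X' ⟶ B₁} {u₂' : X' ⟶ B₂} {w₁ : D₁ ⟶ A'} {w₂ : D₂ ⟶ A'} {f₁ : D₁ ⟶ B₁} {f₂ : D₂ ⟶ B₂}

/-- The 2-morphisms `x` and `y`, from `(x₁, p ∘ w₁, g₁ ∘ f₁)` to `(x₂, p ∘ w₂, g₂ ∘ f₂)`, are
obtained from `α` and `β` by comparing `x₁` and `x₂` with `u₁` and `u₂` through a single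
morphism `k`. -/
def IsPasting (p : A' ⟶ A) (ρ₁ : w₁ ≫ f ≅ f₁ ≫ v₁) (ρ₂ : w₂ ≫ f ≅ f₂ ≫ v₂)
    (α : u₁ ≫ v₁ ≅ u₂ ≫ v₂) (β : u₁ ≫ g₁ ⟶ u₂ ≫ g₂) (x₁ : D ⟶ D₁) (x₂ : D ⟶ D₂)
    (x : x₁ ≫ w₁ ≫ p ⟶ x₂ ≫ w₂ ≫ p) (y : x₁ ≫ f₁ ≫ g₁ ⟶ x₂ ≫ f₂ ≫ g₂) : Prop :=
  ∃ (k : D ⟶ X) (s₁ : x₁ ≫ f₁ ≅ k ≫ u₁) (s₂ : x₂ ≫ f₂ ≅ k ≫ u₂) (φ : x₁ ≫ w₁ ≅ x₂ ≫ w₂),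
    whisk φ.hom f ≫ x₂ ◁ ρ₂.hom ≫ whisk s₂.hom v₂ =
      (x₁ ◁ ρ₁.hom ≫ whisk s₁.hom v₁) ≫ k ◁ α.hom ∧
    x = whisk φ.hom p ∧
    y ≫ whisk s₂.hom g₂ = whisk s₁.hom g₁ ≫ k ◁ β

variable {ρ₁ : w₁ ≫ f ≅ f₁ ≫ v₁} {ρ₂ : w₂ ≫ f ≅ f₂ ≫ v₂} {α : u₁ ≫ v₁ ≅ u₂ ≫ v₂}
  {β : u₁ ≫ g₁ ⟶ u₂ ≫ g₂} {α' : u₁' ≫ v₁ ≅ u₂' ≫ v₂} {β' : u₁' ≫ g₁ ⟶ u₂' ≫ g₂}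
  {x₁ : D ⟶ D₁} {x₂ : D ⟶ D₂} {x₁' : D' ⟶ D₁} {x₂' : D' ⟶ D₂}
  {x : x₁ ≫ w₁ ≫ p ⟶ x₂ ≫ w₂ ≫ p} {y : x₁ ≫ f₁ ≫ g₁ ⟶ x₂ ≫ f₂ ≫ g₂}
  {x' : x₁' ≫ w₁ ≫ p ⟶ x₂' ≫ w₂ ≫ p} {y' : x₁' ≫ f₁ ≫ g₁ ⟶ x₂' ≫ f₂ ≫ g₂}

theorem IsPasting.exists_compatible (hv₁ : W v₁) (hv₂ : W v₂) (hu : W (u₁ ≫ v₁))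
    (hp : W (w₁ ≫ p)) (hw₂ : W w₂) (hx' : W (x₁' ≫ w₁ ≫ p))
    (h : IsPasting p ρ₁ ρ₂ α β x₁ x₂ x y) (h' : IsPasting p ρ₁ ρ₂ α β x₁' x₂' x' y') :
    ∃ (E : C) (e : E ⟶ D) (e' : E ⟶ D') (a₁ : e ≫ x₁ ≅ e' ≫ x₁') (a₂ : e ≫ x₂ ≅ e' ≫ x₂'),
      W e ∧ Compatible x x' a₁.hom a₂.hom ∧ Compatible y y' a₁.hom a₂.hom := by
  obtain ⟨k, s₁, s₂, φ, hφ, rfl, hβ⟩ := h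
  obtain ⟨k', s₁', s₂', φ', hφ', rfl, hβ'⟩ := h'
  -- Three comparisons are built in turn: of the first legs, of the second legs through φ, and of k
  -- with k' through ρ¹ and s¹. The last is lifted along v¹ ∘ u¹, since u¹ alone need not lie in W.
  obtain ⟨E₀, e₀, e₀', he₀, ⟨a₀⟩⟩ := exists_square x₁ hp hx'
  obtain ⟨E₁, p₁, b₁, hp₁, hφφ'⟩ :=
    BicategoryOfFractions.exists_compatible hw₂ φ.hom φ'.hom a₀
  obtain ⟨E₂, p₂, b, hp₂, hk⟩ := BicategoryOfFractions.exists_compatible hu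
    (x₁ ◁ ρ₁.hom ≫ whisk s₁.hom v₁) (x₁' ◁ ρ₁.hom ≫ whisk s₁'.hom v₁) (restrictIso p₁ a₀)
  replace hφφ' := hφφ'.restrict p₂
  have hs₁ := Compatible.of_comp_left (Compatible.whiskerLeft _ _) hk
  have hs₂ := hk.comp (Compatible.whiskerLeft _ α.hom)
  -- The coherence condition trades the path through ρ¹, s¹, α for the one through φ, ρ², s²;
  -- stripping φ and ρ² leaves the statement about s², still composed with v².
  rw [← hφ, ← hφ'] at hs₂
  replace hs₂ := Compatible.of_comp_left (Compatible.whiskerLeft _ _)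
    (Compatible.of_comp_left (hφφ'.whisk f) hs₂)
  obtain ⟨E₃, p₃, hp₃, hs₁⟩ := exists_compatible_of_whisk hv₁ hs₁
  obtain ⟨E₄, p₄, hp₄, hs₂⟩ := exists_compatible_of_whisk hv₂ (hs₂.restrict p₃)
  replace hs₁ := hs₁.restrict p₄
  replace hφφ' := (hφφ'.restrict p₃).restrict p₄
  -- The final comparisons of legs are those for φ, restricted to E₄. As s² is invertible, y may be
  -- tested after composing with it, where it becomes s¹ followed by β.
  refine ⟨E₄, _, _, _, _, ?_, hφφ'.whisk p, Compatible.of_comp_right (hs₂.whisk g₂) ?_⟩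
  · exact AdmitsBicalculus.bf2 _ _ hp₄ (AdmitsBicalculus.bf2 _ _ hp₃
      (AdmitsBicalculus.bf2 _ _ hp₂ (AdmitsBicalculus.bf2 _ _ hp₁ he₀)))
  · rw [hβ, hβ']
    exact (hs₁.whisk g₁).comp (Compatible.whiskerLeft _ _)

/-- Restriction of an identity `x ≫ whisk s₂ = y ≫ k ◁ m` along `e`, followed by replacing `m`
with a 2-morphism `m'` compatible with it. -/
theorem whisk_restrict {F D E X X' Y₁ Y₂ D₁ D₂ Q : C} {e : F ⟶ D} {k : D ⟶ X} {z : E ⟶ X}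
    {z' : E ⟶ X'} {l : F ⟶ E} {x₁ : D ⟶ D₁} {x₂ : D ⟶ D₂} {f₁ : D₁ ⟶ Y₁} {f₂ : D₂ ⟶ Y₂}
    {u₁ : X ⟶ Y₁} {u₂ : X ⟶ Y₂} {u₁' : X' ⟶ Y₁} {u₂' : X' ⟶ Y₂} {c₁ : Y₁ ⟶ Q} {c₂ : Y₂ ⟶ Q}
    (κ : e ≫ k ≅ l ≫ z) (s₁ : x₁ ≫ f₁ ≅ k ≫ u₁) (s₂ : x₂ ≫ f₂ ≅ k ≫ u₂)
    (σ₁ : z' ≫ u₁' ≅ z ≫ u₁) (σ₂ : z ≫ u₂ ≅ z' ≫ u₂')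
    (y : x₁ ≫ f₁ ≫ c₁ ⟶ x₂ ≫ f₂ ≫ c₂) (m : u₁ ≫ c₁ ⟶ u₂ ≫ c₂) (m' : u₁' ≫ c₁ ⟶ u₂' ≫ c₂)
    (h : y ≫ whisk s₂.hom c₂ = whisk s₁.hom c₁ ≫ k ◁ m)
    (hm : σ₁.hom ▷ c₁ ≫ (α_ z u₁ c₁).hom ≫ z ◁ m ≫ (α_ z u₂ c₂).inv ≫ σ₂.hom ▷ c₂ =
      (α_ z' u₁' c₁).hom ≫ z' ◁ m' ≫ (α_ z' u₂' c₂).inv) :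
    ((α_ _ _ _).hom ≫ e ◁ y ≫ (α_ _ _ _).inv) ≫
      whisk ((Iso.refl _ ≪⊗≫ whiskerLeftIso e s₂ ≪⊗≫ whiskerRightIso κ u₂ ≪⊗≫
        whiskerLeftIso l σ₂ ≪⊗≫ Iso.refl _ : (e ≫ x₂) ≫ f₂ ≅ (l ≫ z') ≫ u₂').hom) c₂ =
    whisk ((Iso.refl _ ≪⊗≫ whiskerLeftIso e s₁ ≪⊗≫ whiskerRightIso κ u₁ ≪⊗≫
        whiskerLeftIso l σ₁.symm ≪⊗≫ Iso.refl _ : (e ≫ x₁) ≫ f₁ ≅ (l ≫ z') ≫ u₁').hom) c₁ ≫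
      (l ≫ z') ◁ m' := by
  -- Moving σ¹ across gives the form in which m can be traded for m' once interchange has moved κ
  -- past m.
  have hm' : (α_ z u₁ c₁).hom ≫ z ◁ m ≫ (α_ z u₂ c₂).inv ≫ σ₂.hom ▷ c₂ =
      σ₁.inv ▷ c₁ ≫ (α_ z' u₁' c₁).hom ≫ z' ◁ m' ≫ (α_ z' u₂' c₂).inv := by
    rw [← hm]; simp
  unfold whisk at *
  simp only [bicategoricalIsoComp, Iso.trans_hom, whiskerLeftIso_hom, whiskerRightIso_hom,
    Iso.refl_hom, Iso.symm_hom]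
  calc
    _ = 𝟙 _ ⊗≫ e ◁ (y ≫ (α_ x₂ f₂ c₂).inv ≫ s₂.hom ▷ c₂ ≫ (α_ k u₂ c₂).hom) ⊗≫
        κ.hom ▷ (u₂ ≫ c₂) ⊗≫ l ◁ σ₂.hom ▷ c₂ ⊗≫ 𝟙 _ := by bicategory
    _ = 𝟙 _ ⊗≫ e ◁ s₁.hom ▷ c₁ ⊗≫ ((e ≫ k) ◁ m ≫ κ.hom ▷ (u₂ ≫ c₂)) ⊗≫
        l ◁ σ₂.hom ▷ c₂ ⊗≫ 𝟙 _ := by rw [h]; bicategory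
    _ = 𝟙 _ ⊗≫ e ◁ s₁.hom ▷ c₁ ⊗≫ κ.hom ▷ (u₁ ≫ c₁) ⊗≫
        l ◁ ((α_ z u₁ c₁).hom ≫ z ◁ m ≫ (α_ z u₂ c₂).inv ≫ σ₂.hom ▷ c₂) ⊗≫ 𝟙 _ := by
      rw [whisker_exchange]; bicategory
    _ = _ := by rw [hm']; bicategory

theorem IsPasting.exists_restrict (hu : W (u₁ ≫ v₁)) (h : IsPasting p ρ₁ ρ₂ α β x₁ x₂ x y)
    {E : C} (z : E ⟶ X) (z' : E ⟶ X') (hz : W (z ≫ u₁ ≫ v₁))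
    (σ₁ : z' ≫ u₁' ≅ z ≫ u₁) (σ₂ : z ≫ u₂ ≅ z' ≫ u₂')
    (hα : σ₁.hom ▷ v₁ ≫ (α_ z u₁ v₁).hom ≫ z ◁ α.hom ≫ (α_ z u₂ v₂).inv ≫ σ₂.hom ▷ v₂ =
      (α_ z' u₁' v₁).hom ≫ z' ◁ α'.hom ≫ (α_ z' u₂' v₂).inv)
    (hβ : σ₁.hom ▷ g₁ ≫ (α_ z u₁ g₁).hom ≫ z ◁ β ≫ (α_ z u₂ g₂).inv ≫ σ₂.hom ▷ g₂ =
      (α_ z' u₁' g₁).hom ≫ z' ◁ β' ≫ (α_ z' u₂' g₂).inv) :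
    ∃ (F : C) (e : F ⟶ D), W e ∧ IsPasting p ρ₁ ρ₂ α' β' (e ≫ x₁) (e ≫ x₂)
      ((α_ _ _ _).hom ≫ e ◁ x ≫ (α_ _ _ _).inv) ((α_ _ _ _).hom ≫ e ◁ y ≫ (α_ _ _ _).inv) := by
  obtain ⟨k, s₁, s₂, φ, hφ, rfl, hy⟩ := h
  -- Although z need not lie in W, its composite with v¹ ∘ u¹ does, which suffices for a square with
  -- e in W.
  obtain ⟨F, e, l, he, ⟨κ⟩⟩ := exists_square k hu hz
  refine ⟨F, e, he, l ≫ z', _, _, restrictIso e φ, ?_, ?_,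
    whisk_restrict κ s₁ s₂ σ₁ σ₂ y β β' hy hβ⟩
  -- The coherence condition has the same shape as the one for β once ρ¹ is moved across: α replaces
  -- β and the composite of (ρ¹)⁻¹, φ and ρ² replaces y.
  · rw [Category.assoc, ← whisk_restrict κ s₁ s₂ σ₁ σ₂
      (x₁ ◁ ρ₁.inv ≫ whisk φ.hom f ≫ x₂ ◁ ρ₂.hom) α.hom α'.hom
      (by simp only [Category.assoc, hφ]; simp) hα]
    simp only [← Category.assoc]
    congr 1
    simp [restrictIso, whisk]
  · simp only [restrictIso, whisk, Iso.trans_hom, whiskerLeftIso_hom, Iso.symm_hom]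
    bicategory

end IsPasting

/-- The diagram `d` is obtained from `r` and the chosen squares by pasting. -/
def IsWhiskering (cC : ChoicesC W) {A B Z : C} (f : FracMor W A B) {g₁ g₂ : FracMor W B Z}
    (r : FracRep g₁ g₂) (d : FracRep (cC.comp f g₁) (cC.comp f g₂)) : Prop :=
  IsPasting f.w (cC.fill f.f g₁.w g₁.mem).ρ (cC.fill f.f g₂.w g₂.mem).ρ r.α r.β
    d.v₁ d.v₂ d.α.hom d.β

variable {cC : ChoicesC W} {A B Z : C} {f : FracMor W A B} {g₁ g₂ : FracMor W B Z}
  {r r' : FracRep g₁ g₂} {d d' : FracRep (cC.comp f g₁) (cC.comp f g₂)}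

/-- A restriction of d, equivalent to d, is a pasting over r' as well, which leaves two pastings
over the same representative. -/
theorem IsWhiskering.rel (h : IsWhiskering cC f r d) (hr : r.Rel r')
    (h' : IsWhiskering cC f r' d') : d.Rel d' := by
  obtain ⟨E, z, z', σ₁, σ₂, hz, hα, hβ⟩ := hr
  obtain ⟨F, e, he, h''⟩ := IsPasting.exists_restrict r.mem h z z' hz σ₁ σ₂ hα hβ
  refine FracRep.rel_trans (d.rel_restrict e he) ?_
  obtain ⟨G, l, l', a₁, a₂, hl, hα, hβ⟩ := IsPasting.exists_compatible g₁.mem g₂.mem r'.mem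
    (cC.comp f g₁).mem (cC.fill f.f g₂.w g₂.mem).mem d'.mem h'' h'
  exact FracRep.rel_of_compatible (d := d.restrict e he) hl a₁ a₂ hα hβ

end Whiskerings

/-! ### Induced diagrams and Pronk's diagrams are pastings -/

section Diagrams

variable {C : Type u} [Bicategory.{w, v} C]

section Pasting

variable {A A' B B₁ B₂ B₃ D₁ D₂ D₃ D₄ D₅ Z : C} {f : A' ⟶ B}
  {v₁ : B₁ ⟶ B} {v₂ : B₂ ⟶ B} {g₁ : B₁ ⟶ Z} {g₂ : B₂ ⟶ Z} {u₁ : B₃ ⟶ B₁} {u₂ : B₃ ⟶ B₂}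
  {w₁ : D₁ ⟶ A'} {w₂ : D₂ ⟶ A'} {f₁ : D₁ ⟶ B₁} {f₂ : D₂ ⟶ B₂}
  {t₁ : D₃ ⟶ D₁} {t₂ : D₄ ⟶ D₂} {h₁ : D₃ ⟶ B₃} {h₂ : D₄ ⟶ B₃}
  {t₃ : D₅ ⟶ D₃} {t₄ : D₅ ⟶ D₄}

theorem isIso_zigzag (ρ₁ : w₁ ≫ f ≅ f₁ ≫ v₁) (ρ₂ : w₂ ≫ f ≅ f₂ ≫ v₂) (α : u₁ ≫ v₁ ≅ u₂ ≫ v₂)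
    (σ₁ : t₁ ≫ f₁ ≅ h₁ ≫ u₁) (σ₂ : t₂ ≫ f₂ ≅ h₂ ≫ u₂) (φ : t₃ ≫ t₁ ≫ w₁ ≅ t₄ ≫ t₂ ≫ w₂) :
    IsIso (zigzag ρ₁ ρ₂ α σ₁ σ₂ φ) := by
  unfold zigzag bicategoricalComp
  infer_instance

theorem zigzag_restrict (ρ₁ : w₁ ≫ f ≅ f₁ ≫ v₁) (ρ₂ : w₂ ≫ f ≅ f₂ ≫ v₂)
    (α : u₁ ≫ v₁ ≅ u₂ ≫ v₂) (σ₁ : t₁ ≫ f₁ ≅ h₁ ≫ u₁) (σ₂ : t₂ ≫ f₂ ≅ h₂ ≫ u₂)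
    (φ : t₃ ≫ t₁ ≫ w₁ ≅ t₄ ≫ t₂ ≫ w₂) {E : C} (c : E ⟶ D₅) :
    zigzag ρ₁ ρ₂ α σ₁ σ₂ (restrictIso c φ) =
      𝟙 _ ⊗≫ c ◁ zigzag ρ₁ ρ₂ α σ₁ σ₂ φ ⊗≫ 𝟙 _ := by
  simp only [zigzag, restrictIso, Iso.trans_hom, whiskerLeftIso_hom, Iso.symm_hom]
  bicategory

/-- With k = h² ∘ t⁴, the cells σ¹ and δ form s¹, and σ² is s². Substituting the condition on δ, the
pairs of inverse cells σ¹, ρ¹ and α cancel; in ξ, (σ²)⁻¹ cancels against s². -/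
theorem isPasting_xi (p : A' ⟶ A) (ρ₁ : w₁ ≫ f ≅ f₁ ≫ v₁) (ρ₂ : w₂ ≫ f ≅ f₂ ≫ v₂)
    (α : u₁ ≫ v₁ ≅ u₂ ≫ v₂) (β : u₁ ≫ g₁ ⟶ u₂ ≫ g₂) (σ₁ : t₁ ≫ f₁ ≅ h₁ ≫ u₁)
    (σ₂ : t₂ ≫ f₂ ≅ h₂ ≫ u₂) (φ : t₃ ≫ t₁ ≫ w₁ ≅ t₄ ≫ t₂ ≫ w₂) (δ : t₃ ≫ h₁ ⟶ t₄ ≫ h₂) [IsIso δ]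
    (h : δ ▷ (u₁ ≫ v₁) = zigzag ρ₁ ρ₂ α σ₁ σ₂ φ) :
    IsPasting p ρ₁ ρ₂ α β (t₃ ≫ t₁) (t₄ ≫ t₂) (postcomp p φ).hom (xi σ₁ σ₂ δ β) := by
  refine ⟨t₄ ≫ h₂, Iso.refl _ ≪⊗≫ whiskerLeftIso t₃ σ₁ ≪⊗≫ whiskerRightIso (asIso δ) u₁ ≪⊗≫
    Iso.refl _, Iso.refl _ ≪⊗≫ whiskerLeftIso t₄ σ₂ ≪⊗≫ Iso.refl _,
    α_ _ _ _ ≪≫ φ ≪≫ (α_ _ _ _).symm, ?_, ?_, ?_⟩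
  · simp only [whisk, bicategoricalIsoComp, Iso.trans_hom, whiskerLeftIso_hom,
      whiskerRightIso_hom, Iso.refl_hom, Iso.symm_hom, asIso_hom]
    symm
    calc
      _ = 𝟙 _ ⊗≫ (t₃ ≫ t₁) ◁ ρ₁.hom ⊗≫ t₃ ◁ σ₁.hom ▷ v₁ ⊗≫ δ ▷ (u₁ ≫ v₁) ⊗≫
          (t₄ ≫ h₂) ◁ α.hom ⊗≫ 𝟙 _ := by bicategory
      _ = 𝟙 _ ⊗≫ (t₃ ≫ t₁) ◁ ρ₁.hom ⊗≫ t₃ ◁ (σ₁.hom ≫ σ₁.inv) ▷ v₁ ⊗≫ (t₃ ≫ t₁) ◁ ρ₁.inv ⊗≫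
          φ.hom ▷ f ⊗≫ (t₄ ≫ t₂) ◁ ρ₂.hom ⊗≫ t₄ ◁ σ₂.hom ▷ v₂ ⊗≫
          (t₄ ≫ h₂) ◁ (α.inv ≫ α.hom) ⊗≫ 𝟙 _ := by rw [h, zigzag]; bicategory
      _ = 𝟙 _ ⊗≫ (t₃ ≫ t₁) ◁ (ρ₁.hom ≫ ρ₁.inv) ⊗≫ φ.hom ▷ f ⊗≫ (t₄ ≫ t₂) ◁ ρ₂.hom ⊗≫
          t₄ ◁ σ₂.hom ▷ v₂ ⊗≫ 𝟙 _ := by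
        rw [Iso.hom_inv_id, Iso.inv_hom_id]; bicategory
      _ = _ := by rw [Iso.hom_inv_id]; bicategory
  · simp only [postcomp, whisk, bicategoricalIsoComp, Iso.trans_hom, whiskerRightIso_hom,
      Iso.refl_hom, Iso.symm_hom]
    bicategory
  · simp only [xi, whisk, bicategoricalIsoComp, Iso.trans_hom, whiskerLeftIso_hom,
      whiskerRightIso_hom, Iso.refl_hom, asIso_hom]
    calc
      _ = 𝟙 _ ⊗≫ t₃ ◁ σ₁.hom ▷ g₁ ⊗≫ δ ▷ (u₁ ≫ g₁) ⊗≫ (t₄ ≫ h₂) ◁ β ⊗≫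
          t₄ ◁ (σ₂.inv ≫ σ₂.hom) ▷ g₂ ⊗≫ 𝟙 _ := by bicategory
      _ = _ := by rw [Iso.inv_hom_id]; bicategory

end Pasting

variable {W : MorphismProperty C} [AdmitsBicalculus W] (cC : ChoicesC W) {A B Z : C}
  (f : FracMor W A B) {g₁ g₂ : FracMor W B Z} {r : FracRep g₁ g₂}

theorem WhiskerData.isWhiskering {cC : ChoicesC W} {f : FracMor W A B} (F : WhiskerData cC f r) :
    IsWhiskering cC f r F.diagram :=
  isPasting_xi f.w _ _ r.α r.β F.S₁.ρ F.S₂.ρ F.S₃.ρ F.δ.hom F.eq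

theorem isWhiskering_pronkRep (cD : ChoicesD W) (r : FracRep g₁ g₂) :
    IsWhiskering cC f r (pronkRep cC cD f r) := by
  let S₁ := cC.fill f.f g₁.w g₁.mem
  let S₂ := cC.fill f.f g₂.w g₂.mem
  let P₁ := pronkLeg cC cD f g₁ r.v₁ r.mem
  let P₂ := pronkLeg cC cD f g₂ r.v₂ r.mem₂
  let Q := cC.fill (P₁.t ≫ S₁.v') (P₂.t ≫ S₂.v') P₂.mem
  let K := cD.lift (r.v₁ ≫ g₁.w) r.mem (Q.v' ≫ P₁.h) (Q.f' ≫ P₂.h)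
    (zigzag S₁.ρ S₂.ρ r.α P₁.σ P₂.σ Q.ρ)
  have : IsIso K.β := cD.isIso _ _ _ _ _ (isIso_zigzag _ _ _ _ _ _)
  have hK := K.eq
  -- The cells of `pronkRep` are, by unfolding, the restrictions along c of the chosen square and
  -- the reassociated lift, so the condition on δ is the defining equation of the lift.
  refine isPasting_xi f.w S₁.ρ S₂.ρ r.α r.β P₁.σ P₂.σ (restrictIso K.v Q.ρ)
    ((α_ _ _ _).hom ≫ K.β ≫ (α_ _ _ _).inv) ?_
  rw [zigzag_restrict, hK]
  bicategory

end Diagrams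

end BicategoryOfFractions

theorem mainTheorem5 {C : Type u} [Bicategory.{w, v} C]
    (W : MorphismProperty C) [AdmitsBicalculus W] (cC : ChoicesC W) {A B Z : C}
    (f : FracMor W A B) {g₁ g₂ : FracMor W B Z} (Γ : TwoMor g₁ g₂) :
    -- `Γ ∘ f` is well defined: it may be computed from any representative of `Γ`
    (∀ (cD : ChoicesD W) (r : FracRep g₁ g₂), r.Represents Γ →
      (pronkRep cC cD f r).Represents (compLeft cC cD f Γ)) ∧
    -- any representative of `Γ` and any auxiliary data give a diagram representing `Γ ∘ f`
    (∀ (cD : ChoicesD W) (r : FracRep g₁ g₂), r.Represents Γ →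
      ∀ F : WhiskerData cC f r, F.diagram.Represents (compLeft cC cD f Γ)) ∧
    -- the diagrams obtained from two sets of such choices represent the same 2-morphism
    (∀ r r' : FracRep g₁ g₂, r.Represents Γ → r'.Represents Γ →
      ∀ (F : WhiskerData cC f r) (F' : WhiskerData cC f r'), F.diagram.Rel F'.diagram) ∧
    -- `Γ ∘ f` does not depend on the choices `D(W)`
    (∀ cD cD' : ChoicesD W, compLeft cC cD f Γ = compLeft cC cD' f Γ) := by
  -- Pronk's diagram for `Γ.out`, whose class defines the composite, is itself a pasting, so every
  -- pasting over a representative of Γ is equivalent to it.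
  have key : ∀ (cD : ChoicesD W) (r : FracRep g₁ g₂), r.Represents Γ →
      ∀ d, IsWhiskering cC f r d → d.Represents (compLeft cC cD f Γ) := fun cD r hr d hd =>
    Quotient.sound (hd.rel (Quotient.exact (hr.trans Γ.out_eq.symm))
      (isWhiskering_pronkRep cC f cD Γ.out))
  exact ⟨fun cD r hr => key cD r hr _ (isWhiskering_pronkRep cC f cD r),
    fun cD r hr F => key cD r hr _ F.isWhiskering,
    fun r r' hr hr' F F' => F.isWhiskering.rel (Quotient.exact (hr.trans hr'.symm)) F'.isWhiskering,
    -- Being a pasting does not involve D(W), so `key` for the second set of choices applies to the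
    -- diagram built with the first.
    fun cD cD' => key cD' Γ.out Γ.out_eq _ (isWhiskering_pronkRep cC f cD Γ.out)⟩
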